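/- Let $\tau$ be a finite vocabulary (of predicate, function and constant symbols), let $k \ge 0$ be an integer, and let $\varphi$ be a first-order $\tau$-sentence; all structures are nonempty and may be infinite. The following are equivalent: (1) $\varphi$ is preserved under substructures modulo $k$-sized cores, that is, every model $M$ of $\varphi$ has a set $C$ of at most $k$ elements such that every substructure $N \subseteq M$ whose universe contains $C$ is a model of $\varphi$; (2) $\varphi$ is logically equivalent to a prenex $\tau$-sentence $\exists x_1 \cdots \exists x_k \forall y_1 \cdots \forall y_l\, \theta$ with $\theta$ quantifier-free, that has exactly $k$ existential quantifiers and some number $l \ge 0$ of universal quantifiers (for $k = 0$: to a universal sentence). -/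

import Mathlib

open FirstOrder

universe u v w

namespace CorePreservation

/-- Structures for the vocabulary `L`; as usual in model theory they have a nonempty universe. -/
abbrev Struct (L : FirstOrder.Language.{u, v}) : Type (max u v (w + 1)) :=
  FirstOrder.Language.Theory.ModelType.{u, v, w} (∅ : L.Theory)

/-- A nonempty substructure of a structure, as a structure in its own right. -/
abbrev Struct.ofSubstructure {L : FirstOrder.Language.{u, v}} {M : Struct.{u, v, w} L}
    (N : L.Substructure M) (hN : (N : Set M).Nonempty) : Struct.{u, v, w} L :=
  haveI : Nonempty N := hN.to_subtype
  FirstOrder.Language.Theory.ModelType.of (∅ : L.Theory) N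

/-- `C` is a core of `M` with respect to the class `S`: every substructure of `M` that contains `C`
belongs to `S`. -/
def IsCore {L : FirstOrder.Language.{u, v}} (S : Set (Struct.{u, v, w} L)) (M : Struct.{u, v, w} L)
    (C : Finset M) : Prop :=
  ∀ (N : L.Substructure M) (hN : (N : Set M).Nonempty), (C : Set M) ⊆ (N : Set M) →
    Struct.ofSubstructure N hN ∈ S

/-- The class `S` is preserved under substructures modulo `k`-sized cores. -/
def PreservedModCores {L : FirstOrder.Language.{u, v}} (k : ℕ) (S : Set (Struct.{u, v, w} L)) : Prop :=
  ∀ M ∈ S, ∃ C : Finset M, C.card ≤ k ∧ IsCore S M C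

/-- The class of models of a sentence. -/
def modelClass {L : FirstOrder.Language.{u, v}} (φ : L.Sentence) : Set (Struct.{u, v, w} L) :=
  {M | M ⊨ φ}

/-- Prenex sentences `∃ x₁ … ∃ xₖ ∀ y₁ … ∀ yₗ θ` with exactly `k` existential quantifiers, any
number `l ≥ 0` of universal quantifiers, and `θ` quantifier-free. -/
def IsExistsForall {L : FirstOrder.Language.{u, v}} (k : ℕ) (ψ : L.Sentence) : Prop :=
  ∃ χ : L.BoundedFormula Empty k, χ.IsUniversal ∧ ψ = χ.exs

end CorePreservation

/-! If no single `∃ᵏ∀*` sentence is equivalent to `φ`, neither is any finite disjunction of those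
implying `φ`, as disjunction does not raise `k`. So some ultraproduct `U` of models of `φ` satisfies
`φ` but none of them (`exists_ultraproduct_avoiding`). Let a tuple `a` list a core of `U`. No
universal formula true of `a` forces `φ`, so by compactness and Löwenheim–Skolem a countable `N`
with `N ⊭ φ` has a tuple `b` satisfying all universal formulas true of `a`
(`exists_countable_realize_universal_theory`). Since `U` is ℵ₁-saturated, `N` embeds in `U` with `b
↦ a` (`exists_embedding_ultraproduct`). The image contains the core, so it satisfies `φ`: a
contradiction. -/

namespace CorePreservation

open FirstOrder.Language Filter Set

variable {L : FirstOrder.Language.{u, v}} {k : ℕ}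

/-! ### Universal formulas over a fixed `k`-tuple. -/

section Universal

/-- The structure `M` satisfies `∀ y, θ(a, y)`. -/
def ForallRealize {M : Type w} [L.Structure M] (θ : L.Formula (Fin k ⊕ ℕ)) (a : Fin k → M) : Prop :=
  ∀ y : ℕ → M, θ.Realize (Sum.elim a y)

theorem realize_congr_of_eqOn_freeVars {α : Type*} {n : ℕ} (φ : L.BoundedFormula α n)
    {M : Type*} [L.Structure M] [DecidableEq α] {v v' : α → M} (xs : Fin n → M)
    (h : ∀ i ∈ φ.freeVarFinset, v i = v' i) : φ.Realize v xs ↔ φ.Realize v' xs := by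
  rw [← BoundedFormula.realize_restrictFreeVar' (s := (φ.freeVarFinset : Set α)) subset_rfl,
    ← BoundedFormula.realize_restrictFreeVar' (s := (φ.freeVarFinset : Set α)) subset_rfl (v := v')]
  rw [show v ∘ (Subtype.val : ↥(φ.freeVarFinset : Set α) → α) = v' ∘ Subtype.val from
    funext fun i => h i i.2]

theorem exists_isUniversal_foralls {α : Type*} (l : ℕ) (θ : L.BoundedFormula α (k + l))
    (hθ : θ.IsUniversal) :
    ∃ χ : L.BoundedFormula α k, χ.IsUniversal ∧
      ∀ (M : Type w) [L.Structure M] (v : α → M) (xs : Fin k → M),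
        χ.Realize v xs ↔
          ∀ ys : Fin (k + l) → M, (∀ i, ys (Fin.castAdd l i) = xs i) → θ.Realize v ys := by
  induction l with
  | zero =>
    refine ⟨θ, hθ, fun M _ v xs => ⟨fun h ys hys => ?_, fun h => h xs fun _ => rfl⟩⟩
    rwa [show ys = xs from funext hys]
  | succ l ih =>
    obtain ⟨χ, hχ, h⟩ := ih (BoundedFormula.all θ) hθ.all
    refine ⟨χ, hχ, fun M _ v xs => (h M v xs).trans ⟨fun H ys hys => ?_, fun H ys hys a => ?_⟩⟩
    · have := H (Fin.init (α := fun _ => M) ys) (fun i => hys i) (ys (Fin.last _))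
      exact (Fin.snoc_init_self (α := fun _ => M) ys) ▸ this
    · refine H _ fun i => ?_
      refine Eq.trans ?_ (hys i)
      exact (Fin.snoc_castSucc (α := fun _ => M) a ys (Fin.castAdd l i))

theorem exists_isUniversal_realize_iff (θ : L.Formula (Fin k ⊕ ℕ)) (hθ : θ.IsQF) :
    ∃ χ : L.BoundedFormula Empty k, χ.IsUniversal ∧
      ∀ (M : Type w) [L.Structure M] (v : Empty → M) (xs : Fin k → M),
        χ.Realize v xs ↔ ForallRealize θ xs := by
  classical
  obtain ⟨l, hl⟩ : ∃ l : ℕ, ∀ n, Sum.inr n ∈ θ.freeVarFinset → n ≤ l := by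
    refine ⟨θ.freeVarFinset.sup (Sum.elim (fun _ => 0) id), fun n hn => ?_⟩
    exact Finset.le_sup (f := Sum.elim (fun _ => 0) id) hn
  -- Clamping is harmless since only indices up to `l` occur in `θ`; `l + 1` slots give every index
  -- a target.
  let c : ℕ → Fin (l + 1) := fun n => ⟨min n l, by omega⟩
  let g : Fin k ⊕ ℕ → Empty ⊕ Fin (k + (l + 1)) :=
    Sum.elim (fun i => Sum.inr (Fin.castAdd _ i)) fun n => Sum.inr (Fin.natAdd k (c n))
  obtain ⟨χ, hχ, h⟩ := exists_isUniversal_foralls (l + 1)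
    (BoundedFormula.relabel (k := 0) g θ)
    (hθ.relabel g).isUniversal
  refine ⟨χ, hχ, fun M _ v xs => (h M v xs).trans ?_⟩
  have key : ∀ ys : Fin (k + (l + 1)) → M, (∀ i, ys (Fin.castAdd (l + 1) i) = xs i) →
      ((BoundedFormula.relabel g θ).Realize v ys ↔
        θ.Realize (Sum.elim xs fun n => ys (Fin.natAdd k (c n)))) := by
    intro ys hys
    refine (BoundedFormula.realize_relabel (n := 0)).trans ?_
    rw [Formula.Realize]
    have : (Sum.elim v (ys ∘ Fin.castAdd 0) ∘ g) =
        Sum.elim xs fun n => ys (Fin.natAdd k (c n)) := by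
      funext i
      rcases i with i | n
      · exact hys i
      · rfl
    rw [this, Subsingleton.elim (ys ∘ Fin.natAdd (k + (l + 1))) (default : Fin 0 → M)]
  constructor
  · intro H y
    have h1 : ∀ i, Fin.append xs (fun j : Fin (l + 1) => y j) (Fin.castAdd (l + 1) i) = xs i :=
      fun i => Fin.append_left _ _ _
    have h2 := (key _ h1).1 (H _ h1)
    refine (realize_congr_of_eqOn_freeVars θ default ?_).1 h2
    rintro (i | n) hn
    · rfl
    · simp only [Sum.elim_inr, Fin.append_right, c]
      rw [min_eq_left (hl n hn)]
  · intro H ys hys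
    exact (key ys hys).2 (H _)

/-- The two matrices get disjoint universal variables, the even and the odd ones, but share the
tuple `a`; hence `k` does not grow. -/
theorem exists_forallRealize_or (θ₁ θ₂ : L.Formula (Fin k ⊕ ℕ)) (h₁ : θ₁.IsQF) (h₂ : θ₂.IsQF) :
    ∃ θ : L.Formula (Fin k ⊕ ℕ), θ.IsQF ∧ ∀ (M : Type w) [L.Structure M] (a : Fin k → M),
      ForallRealize θ a ↔ ForallRealize θ₁ a ∨ ForallRealize θ₂ a := by
  refine ⟨θ₁.relabel (Sum.map id fun n => 2 * n) ⊔ θ₂.relabel (Sum.map id fun n => 2 * n + 1),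
    (h₁.relabel _).sup (h₂.relabel _), fun M _ a => ?_⟩
  simp only [ForallRealize, Formula.realize_sup, Formula.realize_relabel, Sum.elim_comp_map,
    Function.comp_id]
  constructor
  · intro H
    by_contra! hc
    obtain ⟨⟨y, hy⟩, z, hz⟩ := hc
    have := H fun n => if n % 2 = 0 then y (n / 2) else z (n / 2)
    have e1 : ((fun n => if n % 2 = 0 then y (n / 2) else z (n / 2)) ∘ fun n => 2 * n) = y := by
      funext n; simp
    have e2 : ((fun n => if n % 2 = 0 then y (n / 2) else z (n / 2)) ∘ fun n => 2 * n + 1) = z := by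
      funext n
      simp only [Function.comp_apply, if_neg (show ¬ (2 * n + 1) % 2 = 0 by omega)]
      congr 1; omega
    rw [e1, e2] at this
    exact this.elim hy hz
  · rintro (H | H) y
    · exact Or.inl (H _)
    · exact Or.inr (H _)

theorem exists_forallRealize_iff_exists_le (θ : ℕ → L.Formula (Fin k ⊕ ℕ)) (h : ∀ n, (θ n).IsQF)
    (n : ℕ) :
    ∃ η : L.Formula (Fin k ⊕ ℕ), η.IsQF ∧ ∀ (M : Type w) [L.Structure M] (a : Fin k → M),
      ForallRealize η a ↔ ∃ j ≤ n, ForallRealize (θ j) a := by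
  induction n with
  | zero => exact ⟨θ 0, h 0, fun M _ a => by simp⟩
  | succ n ih =>
    obtain ⟨η, hη, H⟩ := ih
    obtain ⟨ζ, hζ, H'⟩ := exists_forallRealize_or.{u, v, w} η (θ (n + 1)) hη (h _)
    refine ⟨ζ, hζ, fun M _ a => ?_⟩
    simp only [H', H, Nat.le_succ_iff, or_and_right, exists_or, exists_eq_left]

/-- The conjunction of the first `n + 1` formulas of a sequence. -/
def initialInf {α : Type*} (θ : ℕ → L.Formula α) : ℕ → L.Formula α
  | 0 => θ 0
  | n + 1 => initialInf θ n ⊓ θ (n + 1)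

theorem realize_initialInf {α : Type*} (θ : ℕ → L.Formula α) (n : ℕ) {M : Type*} [L.Structure M]
    (v : α → M) : (initialInf θ n).Realize v ↔ ∀ j ≤ n, (θ j).Realize v := by
  induction n with
  | zero => simp [initialInf]
  | succ n ih =>
    simp only [initialInf, Formula.realize_inf, ih, Nat.le_succ_iff, or_imp, forall_and,
      forall_eq]

theorem isQF_initialInf {α : Type*} {θ : ℕ → L.Formula α} (h : ∀ n, (θ n).IsQF) (n : ℕ) :
    (initialInf θ n).IsQF := by
  induction n with
  | zero => exact h 0
  | succ n ih => exact ih.inf (h _)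

theorem forallRealize_initialInf (θ : ℕ → L.Formula (Fin k ⊕ ℕ)) (n : ℕ) {M : Type*}
    [L.Structure M] (a : Fin k → M) :
    ForallRealize (initialInf θ n) a ↔ ∀ j ≤ n, ForallRealize (θ j) a := by
  simp only [ForallRealize, realize_initialInf]
  exact ⟨fun h j hj y => h y j hj, fun h y j hj => h j hj y⟩

end Universal

/-! ### Countable saturation of ultraproducts. -/

section Ultraproduct

theorem eventually_hyperfilter_ge (j : ℕ) : ∀ᶠ n in (hyperfilter ℕ : Filter ℕ), j ≤ n :=
  Nat.hyperfilter_le_atTop (eventually_ge_atTop j)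

theorem exists_eq_cast {M : ℕ → Type*} {ι : Type*}
    (a : ι → (hyperfilter ℕ : Filter ℕ).Product M) :
    ∃ a' : ι → ∀ n, M n, a = fun i => ((a' i : ∀ n, M n) : (hyperfilter ℕ : Filter ℕ).Product M) :=
  ⟨fun i => (a i).out, funext fun i => (Quotient.out_eq (a i)).symm⟩

variable {M : ℕ → Type w} [∀ n, L.Structure (M n)] [∀ n, Nonempty (M n)]

theorem realize_formula_sumElim_cast {ι κ : Type*} (θ : L.Formula (ι ⊕ κ)) (a : ι → ∀ n, M n)
    (z : κ → ∀ n, M n) :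
    θ.Realize (Sum.elim (fun i => ((a i : ∀ n, M n) : (hyperfilter ℕ : Filter ℕ).Product M))
        fun i => ((z i : ∀ n, M n) : (hyperfilter ℕ : Filter ℕ).Product M)) ↔
      ∀ᶠ n in (hyperfilter ℕ : Filter ℕ),
        θ.Realize (Sum.elim (fun i => a i n) fun i => z i n) := by
  have h := Ultraproduct.realize_formula_cast (u := hyperfilter ℕ) θ (Sum.elim a z)
  have h1 : (fun i => ((Sum.elim a z i : ∀ n, M n) : (hyperfilter ℕ : Filter ℕ).Product M)) =
      Sum.elim (fun i => ((a i : ∀ n, M n) : (hyperfilter ℕ : Filter ℕ).Product M))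
        fun i => ((z i : ∀ n, M n) : (hyperfilter ℕ : Filter ℕ).Product M) := by
    funext i
    rcases i with i | i <;> rfl
  have h2 : ∀ n, (fun i => Sum.elim a z i n) = Sum.elim (fun i => a i n) fun i => z i n := by
    intro n
    funext i
    rcases i with i | i <;> rfl
  simp only [h2] at h
  exact h1 ▸ h

/-- An ultraproduct along the hyperfilter on `ℕ` realizes every countable set of formulas each
finite part of which it satisfies. -/
theorem exists_realize_of_forall_initialInf (θ : ℕ → L.Formula (Fin k ⊕ ℕ))
    (a : Fin k → (hyperfilter ℕ : Filter ℕ).Product M)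
    (h : ∀ n, ∃ y : ℕ → (hyperfilter ℕ : Filter ℕ).Product M,
      (initialInf θ n).Realize (Sum.elim a y)) :
    ∃ z : ℕ → (hyperfilter ℕ : Filter ℕ).Product M, ∀ n, (θ n).Realize (Sum.elim a z) := by
  classical
  obtain ⟨a, rfl⟩ := exists_eq_cast a
  choose y hy using h
  choose y' hy' using fun n => exists_eq_cast (y n)
  let P : ℕ → ℕ → Prop := fun i n =>
    (initialInf θ n).Realize (Sum.elim (fun s => a s i) fun s => y' n s i)
  have hP : ∀ n, ∀ᶠ i in (hyperfilter ℕ : Filter ℕ), P i n := by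
    intro n
    have := hy n
    rw [hy' n] at this
    exact (realize_formula_sumElim_cast _ _ _).1 this
  -- Diagonal choice: coordinate `i` uses the witness for the longest conjunction, of index at most
  -- `i`, that its own witness satisfies there.
  let z : ℕ → ∀ i, M i := fun m i => y' (Nat.findGreatest (P i) i) m i
  refine ⟨fun m => (z m : (hyperfilter ℕ : Filter ℕ).Product M), fun n => ?_⟩
  refine (realize_formula_sumElim_cast _ _ _).2 ?_
  filter_upwards [hP n, eventually_hyperfilter_ge n] with i hi hni
  have h1 : P i (Nat.findGreatest (P i) i) := Nat.findGreatest_spec hni hi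
  exact (realize_initialInf θ _ _).1 h1 n (Nat.le_findGreatest hni hi)

end Ultraproduct

/-! ### Embedding countable structures. -/

section Embedding

theorem exists_embedding_of_realize {N : Type*} {U : Type*} [L.Structure N] [L.Structure U]
    (e : ℕ → N) (he : Function.Surjective e) (b : Fin k → N) (a : Fin k → U) (z : ℕ → U)
    (h : ∀ θ : L.Formula (Fin k ⊕ ℕ), θ.IsQF → θ.Realize (Sum.elim b e) →
      θ.Realize (Sum.elim a z)) :
    ∃ f : N ↪[L] U, f ∘ b = a := by
  have hiff : ∀ θ : L.Formula (Fin k ⊕ ℕ), θ.IsQF →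
      (θ.Realize (Sum.elim a z) ↔ θ.Realize (Sum.elim b e)) := by
    refine fun θ hθ => ⟨fun H => ?_, h θ hθ⟩
    by_contra hc
    exact h θ.not hθ.not hc H
  have heq : ∀ t₁ t₂ : L.Term (Fin k ⊕ ℕ),
      (t₁.realize (Sum.elim a z) = t₂.realize (Sum.elim a z) ↔
        t₁.realize (Sum.elim b e) = t₂.realize (Sum.elim b e)) := by
    intro t₁ t₂
    have := hiff (t₁.equal t₂) (BoundedFormula.IsAtomic.equal _ _).isQF
    simpa only [Formula.realize_equal] using this
  let s := Function.surjInv he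
  have hs : ∀ x, e (s x) = x := Function.surjInv_eq he
  refine ⟨{ toFun := fun x => z (s x), inj' := ?_, map_fun' := ?_, map_rel' := ?_ }, ?_⟩
  · intro x y hxy
    have := (heq (.var (.inr (s x))) (.var (.inr (s y)))).1 hxy
    simpa only [Term.realize_var, Sum.elim_inr, hs] using this
  · intro n F x
    have := heq (.var (.inr (s (Structure.funMap F x)))) (.func F fun i => .var (.inr (s (x i))))
    simp only [Term.realize_var, Term.realize_func, Sum.elim_inr, hs] at this
    exact this.2 trivial
  · intro n R x
    have := hiff (R.formula fun i => .var (.inr (s (x i)))) (BoundedFormula.IsAtomic.rel _ _).isQF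
    simp only [Formula.realize_rel, Term.realize_var, Sum.elim_inr, hs] at this
    exact this
  · funext i
    have := heq (.var (.inr (s (b i)))) (.var (.inl i))
    simp only [Term.realize_var, Sum.elim_inr, Sum.elim_inl, hs] at this
    exact this.2 trivial

theorem exists_embedding_ultraproduct [Countable L.Symbols] {M : ℕ → Type w}
    [∀ n, L.Structure (M n)] [∀ n, Nonempty (M n)] {N : Type*} [L.Structure N] [Countable N]
    [Nonempty N] (b : Fin k → N) (a : Fin k → (hyperfilter ℕ : Filter ℕ).Product M)
    (h : ∀ θ : L.Formula (Fin k ⊕ ℕ), θ.IsQF → ForallRealize θ a → ForallRealize θ b) :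
    ∃ f : N ↪[L] (hyperfilter ℕ : Filter ℕ).Product M, f ∘ b = a := by
  obtain ⟨e, he⟩ := exists_surjective_nat N
  let D : Set (L.Formula (Fin k ⊕ ℕ)) := {θ | θ.IsQF ∧ θ.Realize (Sum.elim b e)}
  obtain ⟨d, hd⟩ := (D.to_countable).exists_eq_range
    ⟨⊤, BoundedFormula.IsQF.top, Formula.realize_top.2 trivial⟩
  have hdD : ∀ n, d n ∈ D := fun n => hd ▸ mem_range_self n
  -- Otherwise the negated conjunction is a universal formula true of `a`, hence of `b`, and the
  -- enumeration `e` of `N` refutes it.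
  obtain ⟨z, hz⟩ := exists_realize_of_forall_initialInf d a fun n => by
    by_contra! hc
    exact h (initialInf d n).not (isQF_initialInf (fun j => (hdD j).1) n).not hc e
      ((realize_initialInf d n _).2 fun j _ => (hdD j).2)
  refine exists_embedding_of_realize e he b a z fun θ h1 h2 => ?_
  obtain ⟨n, rfl⟩ : θ ∈ range d := hd ▸ ⟨h1, h2⟩
  exact hz n

theorem exists_countable_elementarySubstructure [Countable L.Symbols] (N : Type w)
    [L.Structure N] (s : Set N) (hs : s.Countable) :
    ∃ S : L.ElementarySubstructure N, s ⊆ S ∧ Countable S := by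
  by_cases hN : Cardinal.mk N ≤ Cardinal.aleph0
  · have := Cardinal.mk_le_aleph0_iff.1 hN
    exact ⟨⊤, fun _ _ => trivial, Subtype.countable⟩
  · obtain ⟨S, h1, h2⟩ := exists_elementarySubstructure_card_eq L s (Cardinal.aleph0.{0}) le_rfl
      (by simpa using hs) (by
        simpa only [Language.card, Cardinal.lift_aleph0, Cardinal.lift_le_aleph0] using
          Cardinal.mk_le_aleph0_iff.2 ‹Countable L.Symbols›)
      (by simpa using (not_le.1 hN).le)
    refine ⟨S, h1, Cardinal.mk_le_aleph0_iff.1 ?_⟩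
    simpa using h2.le

end Embedding

/-! ### The two implications. -/

section Main

variable {φ : L.Sentence}

theorem exists_ultraproduct_avoiding [Countable L.Symbols]
    (h : ∀ θ : L.Formula (Fin k ⊕ ℕ), θ.IsQF →
      ¬ ∀ M : Struct.{u, v, w} L, M ⊨ φ ↔ ∃ a : Fin k → M, ForallRealize θ a) :
    ∃ M : ℕ → Struct.{u, v, w} L,
      (hyperfilter ℕ : Filter ℕ).Product (fun n => M n) ⊨ φ ∧
        ∀ (a : Fin k → (hyperfilter ℕ : Filter ℕ).Product (fun n => M n))
          (θ : L.Formula (Fin k ⊕ ℕ)), θ.IsQF → ForallRealize θ a →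
            ∃ (N : Struct.{u, v, w} L) (b : Fin k → N), ForallRealize θ b ∧ ¬ N ⊨ φ := by
  let Γ : Set (L.Formula (Fin k ⊕ ℕ)) :=
    {θ | θ.IsQF ∧ ∀ (N : Struct.{u, v, w} L) (b : Fin k → N), ForallRealize θ b → N ⊨ φ}
  obtain ⟨γ, hγ⟩ := Γ.to_countable.exists_eq_range
    -- `⊥` makes `Γ` nonempty, so that it can be enumerated; this uses nonempty universes.
    ⟨⊥, BoundedFormula.isQF_bot, fun N b hb =>
      (Formula.realize_bot.1 (hb fun _ => Classical.arbitrary N)).elim⟩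
  have hγΓ : ∀ n, γ n ∈ Γ := fun n => hγ ▸ mem_range_self n
  have hM : ∀ n, ∃ M : Struct.{u, v, w} L, M ⊨ φ ∧
      ∀ j ≤ n, ∀ a : Fin k → M, ¬ ForallRealize (γ j) a := by
    intro n
    obtain ⟨η, hη, H⟩ :=
      exists_forallRealize_iff_exists_le.{u, v, w} γ (fun j => (hγΓ j).1) n
    by_contra! hc
    refine h η hη fun M => ⟨fun hM => ?_, ?_⟩
    · obtain ⟨j, hj, a, ha⟩ := hc M hM
      exact ⟨a, (H M a).2 ⟨j, hj, ha⟩⟩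
    · rintro ⟨a, ha⟩
      obtain ⟨j, -, hj⟩ := (H M a).1 ha
      exact (hγΓ j).2 M a hj
  choose M hMφ hMγ using hM
  refine ⟨M, (Ultraproduct.sentence_realize φ).2 (Eventually.of_forall hMφ), ?_⟩
  intro a θ hθ ha
  by_contra! hc
  obtain ⟨n, rfl⟩ : θ ∈ range γ := hγ ▸ ⟨hθ, hc⟩
  -- Łoś's theorem needs a genuine sentence, so `∃ x ∀ y, γ n` is rewritten as `χ.exs`.
  obtain ⟨χ, -, hχ⟩ := exists_isUniversal_realize_iff.{u, v, w} (γ n) hθ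
  have h1 : (hyperfilter ℕ : Filter ℕ).Product (fun n => M n) ⊨ χ.exs :=
    BoundedFormula.realize_exs.2 ⟨a, (hχ _ _ _).2 ha⟩
  obtain ⟨i, hi, hni⟩ := (((Ultraproduct.sentence_realize _).1 h1).and
    (eventually_hyperfilter_ge n)).exists
  obtain ⟨x, hx⟩ := BoundedFormula.realize_exs.1 hi
  exact hMγ i n hni x ((hχ _ _ _).1 hx)

theorem exists_countable_realize_universal_theory [Countable L.Symbols] {U : Type*}
    [L.Structure U] (a : Fin k → U)
    (h : ∀ θ : L.Formula (Fin k ⊕ ℕ), θ.IsQF → ForallRealize θ a →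
      ∃ (N : Struct.{u, v, w} L) (b : Fin k → N), ForallRealize θ b ∧ ¬ N ⊨ φ) :
    ∃ (N : Struct.{u, v, w} L) (b : Fin k → N), Countable N ∧ ¬ N ⊨ φ ∧
      ∀ θ : L.Formula (Fin k ⊕ ℕ), θ.IsQF → ForallRealize θ a → ForallRealize θ b := by
  let F : Set (L.Formula (Fin k ⊕ ℕ)) := {θ | θ.IsQF ∧ ForallRealize θ a}
  obtain ⟨d, hd⟩ := F.to_countable.exists_eq_range
    ⟨⊤, BoundedFormula.IsQF.top, fun _ => Formula.realize_top.2 trivial⟩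
  have hdF : ∀ n, d n ∈ F := fun n => hd ▸ mem_range_self n
  choose N b hb hN using fun n => h (initialInf d n) (isQF_initialInf (fun j => (hdF j).1) n)
    ((forallRealize_initialInf d n a).2 fun j _ => (hdF j).2)
  let V := (hyperfilter ℕ : Filter ℕ).Product (fun n => N n)
  let c : Fin k → V := fun i => ((fun n => b n i : ∀ n, N n) : V)
  have hV : ¬ V ⊨ φ := by
    rw [← Sentence.realize_not]
    exact (Ultraproduct.sentence_realize _).2 (Eventually.of_forall fun n =>
      (Sentence.realize_not _).2 (hN n))
  have hc : ∀ n, ForallRealize (d n) c := by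
    intro n y
    obtain ⟨y, rfl⟩ := exists_eq_cast y
    refine (realize_formula_sumElim_cast _ _ _).2 ?_
    filter_upwards [eventually_hyperfilter_ge n] with m hm
    exact (forallRealize_initialInf d m (b m)).1 (hb m) n hm fun i => y i m
  -- Countability is needed because `U` realizes only countable types; universal formulas pass down
  -- to `S`.
  obtain ⟨S, hS, hScount⟩ := exists_countable_elementarySubstructure (L := L) V (range c)
    (countable_range c)
  have : Nonempty S := S.elementarilyEquivalent.symm.nonempty
  have hb' : ∀ n, ForallRealize (d n) fun i : Fin k => (⟨c i, hS (mem_range_self i)⟩ : S) := by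
    intro n y
    rw [← S.subtype.map_formula, Sum.comp_elim]
    exact hc n _
  refine ⟨Theory.ModelType.of ∅ S, fun i => ⟨c i, hS (mem_range_self i)⟩, hScount, ?_, ?_⟩
  · exact fun hφ => hV ((S.realize_sentence φ).1 hφ)
  · intro θ h1 h2
    obtain ⟨n, rfl⟩ : θ ∈ range d := hd ▸ ⟨h1, h2⟩
    exact hb' n

theorem exists_tuple_range_superset {M : Type*} [Nonempty M] (C : Finset M) (hC : C.card ≤ k) :
    ∃ a : Fin k → M, (C : Set M) ⊆ range a := by
  refine ⟨fun i => if h : (i : ℕ) < C.card then C.equivFin.symm ⟨i, h⟩ else Classical.arbitrary M,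
    fun x hx => ?_⟩
  refine ⟨⟨C.equivFin ⟨x, hx⟩, (C.equivFin ⟨x, hx⟩).2.trans_le hC⟩, ?_⟩
  simp

theorem exists_forallRealize_of_preservedModCores [Countable L.Symbols]
    (hφ : PreservedModCores k (modelClass.{u, v, w} φ)) :
    ∃ θ : L.Formula (Fin k ⊕ ℕ), θ.IsQF ∧
      ∀ M : Struct.{u, v, w} L, M ⊨ φ ↔ ∃ a : Fin k → M, ForallRealize θ a := by
  by_contra! hc
  obtain ⟨M, hU, hM⟩ := exists_ultraproduct_avoiding fun θ hθ h => by
    obtain ⟨M, hM⟩ := hc θ hθ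
    have := h M
    tauto
  let U := (hyperfilter ℕ : Filter ℕ).Product (fun n => M n)
  obtain ⟨C, hCk, hC⟩ := hφ (Theory.ModelType.of ∅ U) hU
  obtain ⟨a, ha⟩ := exists_tuple_range_superset (M := U) C hCk
  obtain ⟨N, b, hNc, hNφ, hb⟩ := exists_countable_realize_universal_theory a (hM a)
  obtain ⟨f, hf⟩ := exists_embedding_ultraproduct b a hb
  refine hNφ ?_
  have hCf : ∀ x : U, x ∈ C → x ∈ f.toHom.range := by
    intro x hx
    obtain ⟨i, rfl⟩ := ha (Finset.mem_coe.2 hx)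
    exact ⟨b i, congrFun hf i⟩
  have h1 := hC f.toHom.range ⟨f (Classical.arbitrary N), _, rfl⟩ hCf
  exact (StrongHomClass.realize_sentence f.equivRange φ).2 h1

/-- The existential witnesses form a core, because universal formulas pass to substructures. -/
theorem preservedModCores_of_isExistsForall {ψ : L.Sentence} (hψ : IsExistsForall k ψ)
    (h : ∀ M : Struct.{u, v, w} L, M ⊨ φ ↔ M ⊨ ψ) :
    PreservedModCores k (modelClass.{u, v, w} φ) := by
  classical
  obtain ⟨χ, hχ, rfl⟩ := hψ
  intro M hM
  obtain ⟨x, hx⟩ := BoundedFormula.realize_exs.1 ((h M).1 hM)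
  refine ⟨Finset.univ.image x, Finset.card_image_le.trans (by simp), fun N hN hC => ?_⟩
  refine (h _).2 (BoundedFormula.realize_exs.2 ⟨fun i => ⟨x i, hC (by simp)⟩, ?_⟩)
  refine hχ.realize_embedding N.subtype (?_ : χ.Realize _ x)
  convert hx

theorem iff_empty_iff_forall_struct {ψ : L.Sentence} :
    (φ ⇔[∅] ψ) ↔ ∀ M : Struct.{u, v, max u v w} L, M ⊨ φ ↔ M ⊨ ψ := by
  constructor
  · intro h M
    have := Theory.ModelsBoundedFormula.realize_sentence (φ := φ.iff ψ) h M
    exact Formula.realize_iff.1 this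
  · intro h
    refine Theory.models_sentence_iff (φ := φ.iff ψ) |>.2 fun M => Formula.realize_iff.2 ?_
    -- Consequence is tested on models in the universe `max u v`, so each is lifted to `max u v w`.
    let : L.Structure (ULift.{max u v w} M) := Equiv.ulift.symm.inducedStructure
    have e : M ≃[L] ULift.{max u v w} M := Equiv.ulift.symm.inducedStructureEquiv
    have := h (Theory.ModelType.of ∅ (ULift.{max u v w} M))
    exact ((StrongHomClass.realize_sentence e φ).trans this).trans
      (StrongHomClass.realize_sentence e ψ).symm

end Main

end CorePreservation

theorem theorem2 (L : FirstOrder.Language.{u, v}) [Finite L.Symbols] (k : ℕ) (φ : L.Sentence) :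
    CorePreservation.PreservedModCores k (CorePreservation.modelClass.{u, v, max u v w} φ) ↔
      ∃ ψ : L.Sentence, CorePreservation.IsExistsForall k ψ ∧ φ ⇔[∅] ψ := by
  constructor
  · intro h
    obtain ⟨θ, hθ, H⟩ := CorePreservation.exists_forallRealize_of_preservedModCores h
    obtain ⟨χ, hχ, Hχ⟩ :=
      CorePreservation.exists_isUniversal_realize_iff.{u, v, max u v w} θ hθ
    refine ⟨χ.exs, ⟨χ, hχ, rfl⟩, CorePreservation.iff_empty_iff_forall_struct.{u, v, w}.2
      fun M => (H M).trans ?_⟩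
    exact (exists_congr fun a => (Hχ M _ a).symm).trans
      FirstOrder.Language.BoundedFormula.realize_exs.symm
  · rintro ⟨ψ, hψ, h⟩
    exact CorePreservation.preservedModCores_of_isExistsForall hψ
      (CorePreservation.iff_empty_iff_forall_struct.{u, v, w}.1 h)
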